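/- Let $(\epsilon_k)_{k\in\mathbb Z}$ be i.i.d. real random variables whose law has a density $f_\epsilon$, let $(a_i)_{i\ge 0}$ be real numbers, and let $Z_k=\sum_{i=0}^\infty a_i\epsilon_{k-i}$ $(k\in\mathbb Z)$. Write $F_Z(x)=P(Z_0\le x)$ for the common distribution function and $f_Z=F_Z'$ for its density, normalised pointwise as the derivative of $F_Z$. Let $D\subseteq\mathbb R$ be an open interval (possibly $D=\mathbb R$) with $Z_0\in D$ almost surely, let $g$ be strictly increasing and differentiable on $D$, and put $Y_i=g(Z_i)$. For $n\ge 1$ let $F_n^Y(y)=\frac1n\sum_{i=1}^n\mathbf 1_{\{Y_i\le y\}}$, $\xi_n^Y(p)=\inf\{y: F_n^Y(y)\ge p\}$ and $\widehat g(x)=\widehat g_n(x)=\xi_n^Y(F_Z(x))$. (1) Assume (A2): $f_\epsilon$ is differentiable with $\sup_{x\in\mathbb R}\bigl(f_\epsilon(x)+|f_\epsilon'(x)|\bigr)<\infty$, and there are $\alpha>0$ and $q>2$ such that $E|\epsilon_0|^\alpha<\infty$ and $\sum_{i=n}^\infty |a_i|^{\min(\alpha/q,1)}=O\bigl((\log n)^{-1/q}\bigr)$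 as $n\to\infty$ (in particular these tail sums are finite). Then for every $x$ with $f_Z(x)>0$, $\widehat g_n(x)\to g(x)$ almost surely as $n\to\infty$. (2) Assume, instead of (A2), (A2$^*$): $f_\epsilon$ is twice differentiable with $\sup_{x\in\mathbb R}|f_\epsilon''(x)|<\infty$, and there are $\alpha>0$ and $q\ge 2$ such that $E|\epsilon_0|^\alpha<\infty$ and $\sum_{i=1}^\infty |a_i|^{\min(\alpha/q,1)}<\infty$. Then for all $c\le d$ with $\inf_{c\le x\le d}f_Z(x)>0$, almost surely $\sup_{c\le x\le d}|\widehat g_n(x)-g(x)|\to 0$ as $n\to\infty$. -/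

import Mathlib

open MeasureTheory ProbabilityTheory Filter Topology Asymptotics

namespace MonotoneTransfer

variable {Ω : Type*} [MeasurableSpace Ω]

/-- The causal linear process `Z_k = ∑_{i ≥ 0} a_i ε_{k-i}`, `k ∈ ℤ`. -/
noncomputable def linearProcess (a : ℕ → ℝ) (ε : ℤ → Ω → ℝ) (k : ℤ) (ω : Ω) : ℝ :=
  ∑' i : ℕ, a i * ε (k - (i : ℤ)) ω

/-- The innovations are independent and identically distributed random variables. -/
structure IIDInnovations (P : Measure Ω) (ε : ℤ → Ω → ℝ) : Prop where
  measurable : ∀ k, Measurable (ε k)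
  indep : iIndepFun ε P
  identDistrib : ∀ k, IdentDistrib (ε k) (ε 0) P P

/-- `f` is a (nonnegative, measurable) probability density of the random variable `X`. -/
structure IsDensityOf (P : Measure Ω) (X : Ω → ℝ) (f : ℝ → ℝ) : Prop where
  measurable : Measurable f
  nonneg : ∀ x, 0 ≤ f x
  law : P.map X = volume.withDensity (fun x => ENNReal.ofReal (f x))

/-- Assumption A2 on the innovations and coefficients of the linear process:
short range dependence with a logarithmic rate for the coefficient tails. -/
structure AssumptionA2 (P : Measure Ω) (ε : ℤ → Ω → ℝ) (a : ℕ → ℝ) : Prop where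
  iid : IIDInnovations P ε
  density : ∃ f : ℝ → ℝ, IsDensityOf P (ε 0) f ∧ Differentiable ℝ f ∧
    ∃ C : ℝ, ∀ x, f x + |deriv f x| ≤ C
  coeff : ∃ α q : ℝ, 0 < α ∧ 2 < q ∧
    Integrable (fun ω => |ε 0 ω| ^ α) P ∧
    Summable (fun i : ℕ => |a i| ^ min (α / q) 1) ∧
    (fun n : ℕ => ∑' i : ℕ, |a (n + i)| ^ min (α / q) 1) =O[atTop]
      (fun n : ℕ => Real.log (n : ℝ) ^ (-1 / q))

/-- Assumption A2*: bounded second derivative of the innovation density, and summability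
of the powers of the coefficients. -/
structure AssumptionA2Star (P : Measure Ω) (ε : ℤ → Ω → ℝ) (a : ℕ → ℝ) : Prop where
  iid : IIDInnovations P ε
  density : ∃ f : ℝ → ℝ, IsDensityOf P (ε 0) f ∧ Differentiable ℝ f ∧
    Differentiable ℝ (deriv f) ∧ ∃ C : ℝ, ∀ x, |deriv (deriv f) x| ≤ C
  coeff : ∃ α q : ℝ, 0 < α ∧ 2 ≤ q ∧
    Integrable (fun ω => |ε 0 ω| ^ α) P ∧
    Summable (fun i : ℕ => |a (i + 1)| ^ min (α / q) 1)

/-- The cumulative distribution function `F_X(x) = P(X ≤ x)`. -/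
noncomputable def distFun (P : Measure Ω) (X : Ω → ℝ) (x : ℝ) : ℝ :=
  P.real {ω | X ω ≤ x}

/-- The density `f_X = F_X'`, fixed pointwise as the derivative of the distribution function
(a density is otherwise only determined almost everywhere). It is `0` at points where `F_X` is not
differentiable, so `0 < densityFun P X x` includes differentiability of `F_X` at `x`. -/
noncomputable def densityFun (P : Measure Ω) (X : Ω → ℝ) (x : ℝ) : ℝ :=
  deriv (distFun P X) x

open Classical in
/-- The empirical distribution function `F_n(y) = (1/n) ∑_{i=1}^n 1{Y_i ≤ y}`. -/
noncomputable def empiricalDistFun (Y : ℤ → Ω → ℝ) (n : ℕ) (ω : Ω) (y : ℝ) : ℝ :=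
  (1 / (n : ℝ)) * ∑ i ∈ Finset.Icc 1 n, if Y (i : ℤ) ω ≤ y then (1 : ℝ) else 0

/-- The sample quantile `ξ_n(p) = inf {y | F_n(y) ≥ p}`. -/
noncomputable def sampleQuantile (Y : ℤ → Ω → ℝ) (n : ℕ) (ω : Ω) (p : ℝ) : ℝ :=
  sInf {y : ℝ | p ≤ empiricalDistFun Y n ω y}

/-- The estimator `ĝ(x) = ξ_n^Y(F_Z(x))` of the transfer function `g`, computed from
`Y_i = g(Z_i)`, `1 ≤ i ≤ n`, where `F_Z` is the common distribution function of the stationary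
process `Z`. -/
noncomputable def transferEstimator (P : Measure Ω) (Z : ℤ → Ω → ℝ) (g : ℝ → ℝ)
    (n : ℕ) (ω : Ω) (x : ℝ) : ℝ :=
  sampleQuantile (fun i ω => g (Z i ω)) n ω (distFun P (Z 0) x)

end MonotoneTransfer

namespace MonotoneTransfer

/-! Positivity of `F_Z'` at `x` makes the monotone `F_Z` strictly increasing at `x`, so quantile
consistency needs only that the empirical distribution functions of `Z` are eventually on the
correct side of `F_Z(x)` at points left and right of `x`. Since `g` is strictly increasing, this
ordering passes to the sample `g(Z_i)`, and continuity of `g` finishes part (1). Part (2) is a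
Pólya-type argument: monotone estimators converging pointwise to a continuous limit on a compact
interval converge uniformly.

The probabilistic core is a strong law for bounded Lipschitz functions of `Z`
(`ae_tendsto_linearProcess_average`), applied to ramps squeezed between two indicators. With `β =
min(α/q, 1)`, the variable `|ε|^β` is square integrable and `∑ |a_i|^β` is finite. Truncating `Z` to
`m` terms gives a finitely dependent process, whose strong law follows by splitting into residue
classes. As `t ↦ t^β` is subadditive and bounded Lipschitz functions are `β`-Hölder, the truncation
error is at most a constant times averages of `∑_{j≥m} |a_j|^β |ε_{i-j}|^β`. These must be small
uniformly in large `n`: along `n = 4^k` the variance bound gives summable `L¹` fluctuations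
(`ae_tendsto_weightedFluctuation`), and positivity of the terms fills the gaps at the cost of a
factor 4 (`sum_tsum_tail_le`). -/

/-! ### Inequalities for powers, ramps, and uniform convergence of monotone functions. -/

theorem ennreal_rpow_tsum_le {ι : Type*} (x : ι → ENNReal) {β : ℝ} (h0 : 0 < β) (h1 : β ≤ 1) :
    (∑' i, x i) ^ β ≤ ∑' i, x i ^ β := by
  rw [← ENNReal.le_rpow_inv_iff h0, ENNReal.tsum_eq_iSup_sum]
  refine iSup_le fun s => ?_
  rw [ENNReal.le_rpow_inv_iff h0]
  refine le_trans ?_ (ENNReal.sum_le_tsum s)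
  exact Finset.le_sum_of_subadditive (fun y : ENNReal => y ^ β) (by simp [h0])
    (fun y z => ENNReal.rpow_add_le_add_rpow y z h0.le h1) s x

/-- A bounded Lipschitz function is Hölder of every exponent `β ∈ (0, 1]`. -/
theorem ofReal_abs_sub_le_of_lipschitz {h : ℝ → ℝ} {K : NNReal} (hK : LipschitzWith K h)
    (h01 : ∀ z, h z ∈ Set.Icc (0 : ℝ) 1) {β : ℝ} (hβ0 : 0 < β) (hβ1 : β ≤ 1) (s t : ℝ) :
    ENNReal.ofReal |h s - h t| ≤ (K : ENNReal) ^ β * ‖s - t‖ₑ ^ β := by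
  have e1 : ENNReal.ofReal |h s - h t| = ‖h s - h t‖ₑ := (Real.enorm_eq_ofReal_abs _).symm
  have e2 : ‖h s - h t‖ₑ ≤ K * ‖s - t‖ₑ := by
    simpa [edist_eq_enorm_sub] using hK s t
  have e3 : ‖h s - h t‖ₑ ≤ 1 := by
    rw [← e1, ENNReal.ofReal_le_one, abs_le]
    constructor <;> linarith [(h01 s).1, (h01 s).2, (h01 t).1, (h01 t).2]
  rw [e1, ← ENNReal.mul_rpow_of_nonneg _ _ hβ0.le]
  calc ‖h s - h t‖ₑ = ‖h s - h t‖ₑ ^ (1 : ℝ) := by simp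
    _ ≤ ‖h s - h t‖ₑ ^ β := ENNReal.rpow_le_rpow_of_exponent_ge e3 hβ1
    _ ≤ _ := ENNReal.rpow_le_rpow e2 hβ0.le

/-- The piecewise linear function equal to `1` on `(-∞, u]` and to `0` on `[v, ∞)`. -/
noncomputable def ramp (u v z : ℝ) : ℝ := max 0 (min 1 ((v - u)⁻¹ * (v - z)))

theorem ramp_mem_Icc (u v z : ℝ) : ramp u v z ∈ Set.Icc (0 : ℝ) 1 :=
  ⟨le_max_left _ _, max_le zero_le_one (min_le_left _ _)⟩

theorem exists_lipschitzWith_ramp (u v : ℝ) : ∃ K, LipschitzWith K (ramp u v) := by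
  have h1 : LipschitzWith ‖(v - u)⁻¹‖₊ (fun z : ℝ => (v - u)⁻¹ * (v - z)) :=
    LipschitzWith.of_dist_le_mul fun y z => by
      rw [Real.dist_eq, Real.dist_eq, ← mul_sub, abs_mul, sub_sub_sub_cancel_left, abs_sub_comm z y,
        coe_nnnorm, Real.norm_eq_abs]
  exact ⟨_, (h1.const_min 1).const_max 0⟩

theorem ramp_eq_one {u v z : ℝ} (huv : u < v) (hz : z ≤ u) : ramp u v z = 1 := by
  have : 1 ≤ (v - u)⁻¹ * (v - z) := by
    rw [← div_eq_inv_mul, one_le_div (by linarith)]; linarith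
  simp [ramp, this]

theorem ramp_eq_zero {u v z : ℝ} (huv : u < v) (hz : v ≤ z) : ramp u v z = 0 := by
  have : (v - u)⁻¹ * (v - z) ≤ 0 :=
    mul_nonpos_of_nonneg_of_nonpos (inv_nonneg.2 (by linarith)) (by linarith)
  simp only [ramp]
  exact max_eq_left ((min_le_right _ _).trans this)

open Classical in
theorem indicator_le_ramp {u v : ℝ} (huv : u < v) (z : ℝ) :
    (if z ≤ u then (1 : ℝ) else 0) ≤ ramp u v z := by
  split_ifs with h
  · rw [ramp_eq_one huv h]
  · exact (ramp_mem_Icc u v z).1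

open Classical in
theorem ramp_le_indicator {u v : ℝ} (huv : u < v) (z : ℝ) :
    ramp u v z ≤ if z ≤ v then (1 : ℝ) else 0 := by
  split_ifs with h
  · exact (ramp_mem_Icc u v z).2
  · rw [ramp_eq_zero huv (not_le.1 h).le]

/-- Monotone functions converging pointwise to a continuous function on a compact interval
converge uniformly there. -/
theorem tendstoUniformlyOn_Icc_of_monotoneOn {f : ℕ → ℝ → ℝ} {g : ℝ → ℝ} {c d : ℝ}
    (hmono : ∀ᶠ n in atTop, MonotoneOn (f n) (Set.Icc c d))
    (hg : ContinuousOn g (Set.Icc c d))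
    (hlim : ∀ x ∈ Set.Icc c d, Tendsto (fun n => f n x) atTop (𝓝 (g x))) :
    TendstoUniformlyOn f g atTop (Set.Icc c d) := by
  rw [← tendstoLocallyUniformlyOn_iff_tendstoUniformlyOn_of_compact isCompact_Icc,
    Metric.tendstoLocallyUniformlyOn_iff]
  intro e he x hx
  obtain ⟨δ, hδ, hδg⟩ := Metric.continuousWithinAt_iff.1 (hg x hx) (e / 4) (by linarith)
  -- Monotonicity traps `f n y` between `f n s` and `f n t`, so two points control a whole
  -- neighbourhood of `x`.
  set s := max c (x - δ / 2) with hs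
  set t := min d (x + δ / 2) with ht
  have hsx : s ≤ x := max_le hx.1 (by linarith)
  have hxt : x ≤ t := le_min hx.2 (by linarith)
  have hsc : s ∈ Set.Icc c d := ⟨le_max_left _ _, hsx.trans hx.2⟩
  have htc : t ∈ Set.Icc c d := ⟨hx.1.trans hxt, min_le_left _ _⟩
  have hclose : ∀ y ∈ Set.Icc c d, |y - x| ≤ δ / 2 → |g y - g x| < e / 4 := fun y hy hyx =>
    hδg hy (by rw [Real.dist_eq]; linarith)
  refine ⟨Set.Icc c d ∩ Metric.closedBall x (δ / 2), inter_mem self_mem_nhdsWithin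
    (mem_nhdsWithin_of_mem_nhds (Metric.closedBall_mem_nhds x (by linarith))), ?_⟩
  have h1 := (Metric.tendsto_nhds.1 (hlim s hsc)) (e / 4) (by linarith)
  have h2 := (Metric.tendsto_nhds.1 (hlim t htc)) (e / 4) (by linarith)
  filter_upwards [hmono, h1, h2] with n hn h1 h2 y hy
  obtain ⟨hy, hyx⟩ := hy
  rw [Metric.mem_closedBall, Real.dist_eq] at hyx
  rw [Real.dist_eq, abs_lt] at h1 h2
  have a1 := abs_lt.1 (hclose y hy hyx)
  have a2 := abs_lt.1 (hclose s hsc (by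
    rw [abs_le]; constructor <;> linarith [le_max_right c (x - δ / 2)]))
  have a3 := abs_lt.1 (hclose t htc (by
    rw [abs_le]; constructor <;> linarith [min_le_right d (x + δ / 2)]))
  have b := abs_le.1 hyx
  have m1 := hn hsc hy (max_le hy.1 (by linarith))
  have m2 := hn hy htc (le_min hy.2 (by linarith))
  rw [Real.dist_eq, abs_lt]
  constructor <;> linarith

/-! ### Sample quantiles under a monotone transformation. -/

section Quantile

variable {Ω : Type*}

/-- Two different processes are allowed so that the samples `Z` and `g(Z)` can be compared. -/
theorem empiricalDistFun_mono_of_imp {Y Y' : ℤ → Ω → ℝ} {n : ℕ} {ω : Ω} {y y' : ℝ}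
    (h : ∀ i, Y i ω ≤ y → Y' i ω ≤ y') :
    empiricalDistFun Y n ω y ≤ empiricalDistFun Y' n ω y' := by
  unfold empiricalDistFun
  refine mul_le_mul_of_nonneg_left (Finset.sum_le_sum fun i _ => ?_) (by positivity)
  split_ifs with h1 h2 h2
  · exact le_rfl
  · exact absurd (h _ h1) h2
  · exact zero_le_one
  · exact le_rfl

theorem nonempty_setOf_le_empiricalDistFun (Y : ℤ → Ω → ℝ) {n : ℕ} (hn : 0 < n) (ω : Ω) {p : ℝ}
    (hp : p ≤ 1) : {y : ℝ | p ≤ empiricalDistFun Y n ω y}.Nonempty := by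
  obtain ⟨M, hM⟩ := ((Finset.Icc 1 n).image fun i : ℕ => Y i ω).bddAbove
  refine ⟨M, hp.trans (le_of_eq ?_)⟩
  unfold empiricalDistFun
  rw [Finset.sum_congr rfl fun i hi => if_pos (hM (Finset.mem_coe.2
    (Finset.mem_image_of_mem (fun i : ℕ => Y i ω) hi)))]
  have : (n : ℝ) ≠ 0 := by positivity
  simp [this]

theorem bddBelow_setOf_le_empiricalDistFun (Y : ℤ → Ω → ℝ) (n : ℕ) (ω : Ω) {p : ℝ}
    (hp : 0 < p) : BddBelow {y : ℝ | p ≤ empiricalDistFun Y n ω y} := by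
  obtain ⟨M, hM⟩ := ((Finset.Icc 1 n).image fun i : ℕ => Y i ω).bddBelow
  refine ⟨M, fun y hy => ?_⟩
  by_contra! hlt
  refine absurd hy (not_le.2 (lt_of_eq_of_lt ?_ hp))
  unfold empiricalDistFun
  rw [Finset.sum_congr rfl fun i hi => if_neg (not_le.2 (hlt.trans_le (hM (Finset.mem_coe.2
    (Finset.mem_image_of_mem (fun i : ℕ => Y i ω) hi)))))]
  simp

/-- The bounds `0 < p`, `p' ≤ 1` and `0 < n` exclude the default value `0` of `sInf` on empty or
unbounded sets. -/
theorem sampleQuantile_mono (Y : ℤ → Ω → ℝ) {n : ℕ} (hn : 0 < n) (ω : Ω) {p p' : ℝ}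
    (hp : 0 < p) (hp' : p' ≤ 1) (h : p ≤ p') :
    sampleQuantile Y n ω p ≤ sampleQuantile Y n ω p' :=
  csInf_le_csInf (bddBelow_setOf_le_empiricalDistFun Y n ω hp)
    (nonempty_setOf_le_empiricalDistFun Y hn ω hp') fun _ hy => h.trans hy

/-- Consistency of the sample quantiles of the transformed sample `g(Z_i)`. -/
theorem tendsto_sampleQuantile_comp {Z : ℤ → Ω → ℝ} {ω : Ω} {D : Set ℝ} (hD : IsOpen D)
    {g : ℝ → ℝ} (hg : StrictMonoOn g D) (hZ : ∀ i, Z i ω ∈ D) {x p : ℝ} (hx : x ∈ D)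
    (hgx : ContinuousAt g x)
    (hup : ∀ y, x < y → ∀ᶠ n in atTop, p ≤ empiricalDistFun Z n ω y)
    (hlow : ∀ y, y < x → ∀ᶠ n in atTop, empiricalDistFun Z n ω y < p) :
    Tendsto (fun n => sampleQuantile (fun i ω => g (Z i ω)) n ω p) atTop (𝓝 (g x)) := by
  rw [Metric.tendsto_nhds]
  intro e he
  obtain ⟨δ, hδ, hball⟩ := Metric.mem_nhds_iff.1 (inter_mem (hD.mem_nhds hx)
    (hgx (Metric.ball_mem_nhds (g x) he)))
  have hu := @hball (x + δ / 2) (by simp [abs_of_pos hδ]; linarith)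
  have hl := @hball (x - δ / 2) (by simp [abs_of_pos hδ]; linarith)
  have hu2 := abs_lt.1 (Metric.mem_ball.1 hu.2)
  have hl2 := abs_lt.1 (Metric.mem_ball.1 hl.2)
  filter_upwards [hup (x + δ / 2) (by linarith), hlow (x - δ / 2) (by linarith)] with n h1 h2
  -- The two values `g (x ± δ / 2)`, both within `e` of `g x`, bracket the quantile.
  have hmem : g (x + δ / 2) ∈ {y : ℝ | p ≤ empiricalDistFun (fun i ω => g (Z i ω)) n ω y} :=
    h1.trans (empiricalDistFun_mono_of_imp fun i hi => (hg.le_iff_le (hZ i) hu.1).2 hi)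
  have hbd : ∀ y ∈ {y : ℝ | p ≤ empiricalDistFun (fun i ω => g (Z i ω)) n ω y},
      g (x - δ / 2) ≤ y := by
    intro y hy
    by_contra! hlt
    refine absurd hy (not_le.2 (lt_of_le_of_lt (empiricalDistFun_mono_of_imp fun i hi => ?_) h2))
    exact (hg.le_iff_le (hZ i) hl.1).1 (hi.trans hlt.le)
  have c1 := csInf_le ⟨_, hbd⟩ hmem
  have c2 := le_csInf ⟨_, hmem⟩ hbd
  rw [Real.dist_eq, abs_lt]
  unfold sampleQuantile
  constructor <;> linarith

end Quantile

/-! ### Strong law under finite-range dependence. -/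

/-- The strong law for `[0, 1]`-valued identically distributed variables which are independent at
distance at least `m`. -/
theorem strong_law_ae_of_finite_range_dependence {Ω : Type*} [MeasurableSpace Ω] {P : Measure Ω}
    [IsProbabilityMeasure P] {X : ℕ → Ω → ℝ} {m : ℕ} (hm : 0 < m)
    (hX : ∀ i, Measurable (X i)) (h01 : ∀ i ω, X i ω ∈ Set.Icc (0 : ℝ) 1)
    (hident : ∀ i, IdentDistrib (X i) (X 0) P P)
    (hindep : ∀ i j, i + m ≤ j → X i ⟂ᵢ[P] X j) :
    ∀ᵐ ω ∂P, Tendsto (fun n : ℕ => (∑ i ∈ Finset.range n, X i ω) / n) atTop (𝓝 (∫ ω, X 0 ω ∂P)) := by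
  -- Along a residue class modulo `m` the variables are pairwise independent, so Etemadi's strong
  -- law applies.
  have key : ∀ r : ℕ, ∀ᵐ ω ∂P, Tendsto
      (fun k : ℕ => (∑ l ∈ Finset.range k, X (l * m + r) ω) / k) atTop (𝓝 (∫ ω, X 0 ω ∂P)) := by
    intro r
    have hlt : ∀ l l', l < l' → X (l * m + r) ⟂ᵢ[P] X (l' * m + r) := fun l l' h =>
      hindep _ _ (by nlinarith [Nat.mul_le_mul_right m (Nat.succ_le_of_lt h)])
    have h := strong_law_ae_real (μ := P) (fun l => X (l * m + r))
      (Integrable.of_mem_Icc 0 1 (hX _).aemeasurable (Eventually.of_forall fun ω => h01 _ ω))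
      (fun l l' hll => by
        rcases lt_or_gt_of_ne hll with h | h
        · exact hlt _ _ h
        · exact (hlt _ _ h).symm)
      (fun l => (hident _).trans (hident _).symm)
    rwa [(hident (0 * m + r)).integral_eq] at h
  filter_upwards [ae_all_iff.2 key] with ω hω
  set E := ∫ ω, X 0 ω ∂P
  have hblock : ∀ k : ℕ, ∑ i ∈ Finset.range (k * m), X i ω =
      ∑ r ∈ Finset.range m, ∑ l ∈ Finset.range k, X (l * m + r) ω := by
    intro k
    induction k with
    | zero => simp
    | succ k ih =>
      rw [Nat.succ_mul, Finset.sum_range_add, ih, ← Finset.sum_add_distrib]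
      simp [Finset.sum_range_succ]
  have hA : Tendsto (fun k : ℕ => (∑ i ∈ Finset.range (k * m), X i ω) / k) atTop (𝓝 (m * E)) := by
    have h := tendsto_finsetSum (Finset.range m) fun r _ => hω r
    simp only [Finset.sum_const, Finset.card_range, nsmul_eq_mul] at h
    refine h.congr fun k => ?_
    rw [hblock, Finset.sum_div]
  have hdiv : Tendsto (fun n : ℕ => ((n / m : ℕ) : ℝ) / n) atTop (𝓝 (m : ℝ)⁻¹) := by
    have h := (tendsto_nat_floor_mul_div_atTop (R := ℝ) (a := (m : ℝ)⁻¹) (by positivity)).comp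
      tendsto_natCast_atTop_atTop
    refine h.congr fun n => ?_
    simp only [Function.comp]
    rw [← div_eq_inv_mul, Nat.floor_div_eq_div]
  have hB : Tendsto (fun n : ℕ => (∑ i ∈ Finset.range (n / m * m), X i ω) / n) atTop (𝓝 E) := by
    have h := (hA.comp (Nat.tendsto_div_const_atTop hm.ne')).mul hdiv
    have hE : m * E * (m : ℝ)⁻¹ = E := by
      have : (m : ℝ) ≠ 0 := by positivity
      field_simp
    rw [hE] at h
    refine h.congr' ?_
    filter_upwards [eventually_ge_atTop m] with n hn
    have : ((n / m : ℕ) : ℝ) ≠ 0 := by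
      exact_mod_cast (Nat.div_pos hn hm).ne'
    simp only [Function.comp]
    field_simp
  have hC : Tendsto (fun n : ℕ => (∑ i ∈ Finset.range (n / m * m), X i ω) / n + m / n) atTop
      (𝓝 E) := by
    simpa using hB.add (tendsto_const_div_atTop_nhds_zero_nat (m : ℝ))
  -- The incomplete last block has fewer than `m` terms, each in `[0, 1]`.
  refine tendsto_of_tendsto_of_tendsto_of_le_of_le hB hC (fun n => ?_) fun n => ?_
  · refine div_le_div_of_nonneg_right ?_ (Nat.cast_nonneg n)
    exact Finset.sum_le_sum_of_subset_of_nonneg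
      (Finset.range_mono (Nat.div_mul_le_self n m)) fun i _ _ => (h01 i ω).1
  · rw [← add_div]
    refine div_le_div_of_nonneg_right ?_ (Nat.cast_nonneg n)
    have hn : n = n / m * m + n % m := (Nat.div_add_mod' n m).symm
    conv_lhs => rw [hn, Finset.sum_range_add]
    gcongr
    calc _ ≤ ∑ i ∈ Finset.range (n % m), (1 : ℝ) := Finset.sum_le_sum fun i _ => (h01 _ ω).2
      _ = (n % m : ℕ) := by simp
      _ ≤ m := by exact_mod_cast (Nat.mod_lt n hm).le

end MonotoneTransfer

namespace MonotoneTransfer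

/-! ### Moment bounds and the truncated process. -/

section Law

variable {Ω : Type*} [MeasurableSpace Ω] {P : Measure Ω} [IsProbabilityMeasure P]

/-- An `L¹` bound for the centred averages of independent square integrable variables. -/
theorem lintegral_abs_average_sub_le {ι : Type*} {W : ι → Ω → ℝ} {s : Finset ι} {i₀ : ι}
    (hs : s.Nonempty) (hL2 : MemLp (W i₀) 2 P) (hident : ∀ i, IdentDistrib (W i) (W i₀) P P)
    (hindep : Pairwise fun i j => W i ⟂ᵢ[P] W j) {t : ℝ} (ht : 0 < t) :
    ∫⁻ ω, ENNReal.ofReal |(∑ i ∈ s, W i ω) / s.card - ∫ ω, W i₀ ω ∂P| ∂P ≤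
      ENNReal.ofReal (t + variance (W i₀) P / s.card / t) := by
  have hN : (0 : ℝ) < s.card := by exact_mod_cast hs.card_pos
  have hL : ∀ i, MemLp (W i) 2 P := fun i => (hident i).memLp_iff.2 hL2
  set A : Ω → ℝ := fun ω => (s.card : ℝ)⁻¹ * (∑ i ∈ s, W i) ω with hA
  have hAL : MemLp A 2 P := (memLp_finsetSum' s fun i _ => hL i).const_mul _
  have hEA : ∫ ω, A ω ∂P = ∫ ω, W i₀ ω ∂P := by
    simp only [hA, Finset.sum_apply]
    rw [integral_const_mul, integral_finsetSum _ fun i _ => (hL i).integrable one_le_two,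
      Finset.sum_congr rfl fun i _ => (hident i).integral_eq, Finset.sum_const, nsmul_eq_mul]
    field_simp
  have hvar : variance A P = variance (W i₀) P / s.card := by
    rw [hA, variance_const_mul, IndepFun.variance_sum (fun i _ => hL i) (fun i _ j _ h => hindep h),
      Finset.sum_congr rfl fun i _ => (hident i).variance_eq, Finset.sum_const, nsmul_eq_mul]
    field_simp
  have hsq : Integrable (fun ω => (A ω - ∫ ω, W i₀ ω ∂P) ^ 2) P :=
    (hAL.sub (memLp_const _)).integrable_sq
  have hvar' : ∫ ω, (A ω - ∫ ω, W i₀ ω ∂P) ^ 2 ∂P = variance (W i₀) P / s.card := by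
    rw [← hvar, variance_eq_integral hAL.aestronglyMeasurable.aemeasurable, hEA]
  -- This trades the first moment for the second, leaving `t` free to balance against the variance.
  have hle : ∀ y : ℝ, |y| ≤ t + y ^ 2 / t := by
    intro y
    rw [← sub_le_iff_le_add', le_div_iff₀ ht, ← sq_abs y]
    nlinarith [sq_nonneg (|y| - t), abs_nonneg y]
  calc _ ≤ ∫⁻ ω, ENNReal.ofReal (t + (A ω - ∫ ω, W i₀ ω ∂P) ^ 2 / t) ∂P := by
        refine lintegral_mono fun ω => ENNReal.ofReal_le_ofReal ?_
        have h : (∑ i ∈ s, W i ω) / s.card = A ω := by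
          simp [hA, Finset.sum_apply, div_eq_inv_mul]
        rw [h]
        exact hle _
    _ = _ := by
        have hint : Integrable (fun ω => t + (A ω - ∫ ω, W i₀ ω ∂P) ^ 2 / t) P :=
          (integrable_const t).add (hsq.div_const t)
        rw [← ofReal_integral_eq_lintegral_ofReal hint
          (Eventually.of_forall fun ω => by positivity),
          integral_add (integrable_const t) (hsq.div_const t), integral_div, hvar']
        simp

/-- Independent innovations with enough moments for the `β`-th powers of the coefficients. -/
structure MomentCondition (P : Measure Ω) (ε : ℤ → Ω → ℝ) (a : ℕ → ℝ) (β : ℝ) : Prop where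
  iid : IIDInnovations P ε
  pos : 0 < β
  le_one : β ≤ 1
  memLp : MemLp (fun ω => |ε 0 ω| ^ β) 2 P
  summable : Summable fun i => |a i| ^ β

variable {ε : ℤ → Ω → ℝ} {a : ℕ → ℝ} {β : ℝ}

theorem enorm_rpow_eq_ofReal (x : ℝ) (hβ : 0 < β) : ‖x‖ₑ ^ β = ENNReal.ofReal (|x| ^ β) := by
  rw [Real.enorm_eq_ofReal_abs, ENNReal.ofReal_rpow_of_nonneg (abs_nonneg x) hβ.le]

/-- No summability is needed: a divergent real series has sum `0` by convention. -/
theorem enorm_tsum_rpow_le (hβ0 : 0 < β) (hβ1 : β ≤ 1) (c x : ℕ → ℝ) :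
    ‖∑' i, c i * x i‖ₑ ^ β ≤ ∑' i, ‖c i‖ₑ ^ β * ‖x i‖ₑ ^ β := by
  refine (ENNReal.rpow_le_rpow enorm_tsum_le_tsum_enorm hβ0.le).trans
    ((ennreal_rpow_tsum_le _ hβ0 hβ1).trans_eq ?_)
  simp_rw [enorm_mul, ENNReal.mul_rpow_of_nonneg _ _ hβ0.le]

theorem summable_mul_of_tsum_rpow_lt_top (hβ0 : 0 < β) (hβ1 : β ≤ 1) {c x : ℕ → ℝ}
    (h : ∑' i, ‖c i‖ₑ ^ β * ‖x i‖ₑ ^ β < ⊤) : Summable fun i => c i * x i := by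
  refine Summable.of_enorm fun htop => ?_
  have h1 := ennreal_rpow_tsum_le (fun i => ‖c i * x i‖ₑ) hβ0 hβ1
  rw [htop, ENNReal.top_rpow_of_pos hβ0] at h1
  simp_rw [enorm_mul, ENNReal.mul_rpow_of_nonneg _ _ hβ0.le] at h1
  exact h.not_ge h1

namespace MomentCondition

omit [IsProbabilityMeasure P] in
theorem identDistrib_abs_rpow (h : MomentCondition P ε a β) (k : ℤ) :
    IdentDistrib (fun ω => |ε k ω| ^ β) (fun ω => |ε 0 ω| ^ β) P P :=
  (h.iid.identDistrib k).comp (u := fun x : ℝ => |x| ^ β) (by fun_prop)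

omit [IsProbabilityMeasure P] in
theorem tsum_enorm_rpow_ne_top (h : MomentCondition P ε a β) : ∑' i, ‖a i‖ₑ ^ β ≠ ⊤ := by
  simp_rw [enorm_rpow_eq_ofReal _ h.pos]
  exact h.summable.tsum_ofReal_ne_top

theorem lintegral_enorm_rpow (h : MomentCondition P ε a β) (k : ℤ) :
    ∫⁻ ω, ‖ε k ω‖ₑ ^ β ∂P = ENNReal.ofReal (∫ ω, |ε 0 ω| ^ β ∂P) := by
  simp_rw [enorm_rpow_eq_ofReal _ h.pos]
  rw [← (h.identDistrib_abs_rpow k).integral_eq, ofReal_integral_eq_lintegral_ofReal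
    (((h.identDistrib_abs_rpow k).memLp_iff.2 h.memLp).integrable one_le_two)
    (Eventually.of_forall fun ω => by positivity)]

theorem ae_tsum_lt_top (h : MomentCondition P ε a β) :
    ∀ᵐ ω ∂P, ∀ k : ℤ, ∑' i : ℕ, ‖a i‖ₑ ^ β * ‖ε (k - i) ω‖ₑ ^ β < ⊤ := by
  have hm := h.iid.measurable
  refine ae_all_iff.2 fun k => ae_lt_top' (by fun_prop) ?_
  rw [lintegral_tsum (fun i => by fun_prop)]
  have : ∀ i : ℕ, ∫⁻ ω, ‖a i‖ₑ ^ β * ‖ε (k - i) ω‖ₑ ^ β ∂P =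
      ‖a i‖ₑ ^ β * ENNReal.ofReal (∫ ω, |ε 0 ω| ^ β ∂P) := fun i => by
    rw [lintegral_const_mul _ (by fun_prop), h.lintegral_enorm_rpow]
  simp_rw [this]
  rw [ENNReal.tsum_mul_right]
  exact ENNReal.mul_ne_top h.tsum_enorm_rpow_ne_top ENNReal.ofReal_ne_top

end MomentCondition

/-- The truncation of the linear process to its first `m` terms. -/
noncomputable def truncatedProcess (a : ℕ → ℝ) (ε : ℤ → Ω → ℝ) (m : ℕ) (k : ℤ) (ω : Ω) : ℝ :=
  ∑ i ∈ Finset.range m, a i * ε (k - (i : ℤ)) ω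

omit [IsProbabilityMeasure P] in
theorem measurable_truncatedProcess (hε : IIDInnovations P ε) (m : ℕ) (k : ℤ) :
    Measurable (truncatedProcess a ε m k) := by
  have := hε.measurable
  unfold truncatedProcess
  fun_prop

omit [IsProbabilityMeasure P] in
-- Both laws are the same infinite product measure; every stationarity statement is derived from
-- this one.
theorem identDistrib_shift (hε : IIDInnovations P ε) (k : ℤ) :
    IdentDistrib (fun ω (i : ℕ) => ε (k - i) ω) (fun ω (i : ℕ) => ε (0 - i) ω) P P := by
  have hinj : ∀ k : ℤ, Function.Injective fun i : ℕ => k - (i : ℤ) := fun k i j hij => by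
    simpa using hij
  have hmap : ∀ k : ℤ, P.map (fun ω (i : ℕ) => ε (k - i) ω) =
      Measure.infinitePi fun _ : ℕ => P.map (ε 0) := fun k => by
    rw [(hε.indep.precomp (hinj k)).map_fun_eq_infinitePi_map fun i => hε.measurable _]
    exact congrArg _ (funext fun i => (hε.identDistrib _).map_eq)
  have hm := hε.measurable
  exact ⟨by fun_prop, by fun_prop, (hmap k).trans (hmap 0).symm⟩

omit [IsProbabilityMeasure P] in
theorem identDistrib_truncatedProcess (hε : IIDInnovations P ε) (m : ℕ) (k : ℤ) :
    IdentDistrib (truncatedProcess a ε m k) (truncatedProcess a ε m 0) P P :=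
  (identDistrib_shift hε k).comp (u := fun x : ℕ → ℝ => ∑ i ∈ Finset.range m, a i * x i)
    (by fun_prop)

omit [IsProbabilityMeasure P] in
theorem indepFun_truncatedProcess (hε : IIDInnovations P ε) (m : ℕ) {k l : ℤ} (hkl : k + m ≤ l) :
    truncatedProcess a ε m k ⟂ᵢ[P] truncatedProcess a ε m l := by
  -- The truncated values depend on disjoint windows of innovations.
  have hdisj : Disjoint (Finset.Ioc (k - m) k) (Finset.Ioc (l - m) l) := by
    rw [Finset.disjoint_left]
    intro x hx hy
    simp only [Finset.mem_Ioc] at hx hy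
    omega
  have hind := hε.indep.indepFun_finset _ _ hdisj hε.measurable
  have hcomp : ∀ k : ℤ, ∃ φ : (Finset.Ioc (k - m) k → ℝ) → ℝ, Measurable φ ∧
      truncatedProcess a ε m k = φ ∘ fun ω (i : Finset.Ioc (k - m) k) => ε i ω := by
    intro k
    refine ⟨fun y => ∑ i ∈ (Finset.range m).attach, a i * y ⟨k - (i : ℕ), ?_⟩, ?_, ?_⟩
    · have := Finset.mem_range.1 i.2
      simp only [Finset.mem_Ioc]
      omega
    · fun_prop
    · ext ω
      simp only [truncatedProcess, Function.comp]
      rw [← Finset.sum_attach]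
  obtain ⟨φ, hφ, eφ⟩ := hcomp k
  obtain ⟨ψ, hψ, eψ⟩ := hcomp l
  rw [eφ, eψ]
  exact hind.comp hφ hψ

theorem sum_Icc_one_eq_sum_range {M : Type*} [AddCommMonoid M] (f : ℕ → M) (n : ℕ) :
    ∑ i ∈ Finset.Icc 1 n, f i = ∑ i ∈ Finset.range n, f (i + 1) := by
  rw [Finset.sum_bij' (fun i _ => i - 1) (fun i _ => i + 1)] <;> simp <;> grind

/-- The strong law for a function of the truncated process. -/
theorem ae_tendsto_average_truncatedProcess (hε : IIDInnovations P ε) (m : ℕ) {h : ℝ → ℝ}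
    (hh : Measurable h) (h01 : ∀ z, h z ∈ Set.Icc (0 : ℝ) 1) :
    ∀ᵐ ω ∂P, Tendsto
      (fun n : ℕ => (∑ i ∈ Finset.Icc 1 n, h (truncatedProcess a ε m (i : ℕ) ω)) / n) atTop
      (𝓝 (∫ ω, h (truncatedProcess a ε m 0 ω) ∂P)) := by
  have hid := fun k : ℤ => (identDistrib_truncatedProcess (a := a) hε m k).comp hh
  -- Range `m + 1` instead of `m` keeps the block length positive when `m = 0`.
  have H := strong_law_ae_of_finite_range_dependence (P := P) (m := m + 1)
    (X := fun i ω => h (truncatedProcess a ε m ((i + 1 : ℕ) : ℤ) ω)) (Nat.succ_pos m)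
    (fun i => hh.comp (measurable_truncatedProcess hε m _)) (fun i ω => h01 _)
    (fun i => (hid _).trans (hid _).symm)
    (fun i j hij => (indepFun_truncatedProcess hε m (by push_cast; omega)).comp hh hh)
  have e := (hid ((0 + 1 : ℕ) : ℤ)).integral_eq
  simp only [Function.comp_def] at e
  rw [e] at H
  filter_upwards [H] with ω hω
  refine hω.congr fun n => ?_
  rw [sum_Icc_one_eq_sum_range fun i : ℕ => h (truncatedProcess a ε m (i : ℕ) ω)]

end Law

end MonotoneTransfer

namespace MonotoneTransfer

/-! ### Control of the tails and strong law for the linear process. -/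

section Law

variable {Ω : Type*} [MeasurableSpace Ω] {P : Measure Ω} {ε : ℤ → Ω → ℝ} {a : ℕ → ℝ} {β : ℝ}

/-- The weighted fluctuation, over all shifts, of the averages of `|ε|^β` over `4^k` terms. -/
noncomputable def weightedFluctuation (P : Measure Ω) (ε : ℤ → Ω → ℝ) (a : ℕ → ℝ) (β : ℝ) (k : ℕ)
    (ω : Ω) : ENNReal :=
  ∑' j : ℕ, ‖a j‖ₑ ^ β * ENNReal.ofReal |(∑ i ∈ Finset.Icc 1 (4 ^ k),
    |ε ((i : ℕ) - (j : ℤ)) ω| ^ β) / (Finset.Icc 1 (4 ^ k)).card - ∫ ω, |ε 0 ω| ^ β ∂P|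

theorem identDistrib_linearProcess [IsProbabilityMeasure P] (h : MomentCondition P ε a β) (k : ℤ) :
    IdentDistrib (linearProcess a ε k) (linearProcess a ε 0) P P := by
  have hε := h.iid.measurable
  refine (identDistrib_shift h.iid k).comp_of_aemeasurable (u := fun x : ℕ → ℝ => ∑' i, a i * x i) ?_
  -- The series functional is the limit of its partial sums only almost everywhere, under the law of
  -- the innovations.
  refine aemeasurable_of_tendsto_metrizable_ae atTop
    (f := fun m (x : ℕ → ℝ) => ∑ i ∈ Finset.range m, a i * x i)
    (fun m => (by fun_prop : Measurable fun x : ℕ → ℝ => ∑ i ∈ Finset.range m, a i * x i).aemeasurable) ?_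
  have hae : ∀ᵐ x ∂(P.map fun ω (i : ℕ) => ε (k - i) ω), ∑' i, ‖a i‖ₑ ^ β * ‖x i‖ₑ ^ β < ⊤ := by
    rw [ae_map_iff (by fun_prop) (measurableSet_lt (by fun_prop) measurable_const)]
    filter_upwards [h.ae_tsum_lt_top] with ω hω using hω k
  filter_upwards [hae] with x hx
  exact (summable_mul_of_tsum_rpow_lt_top h.pos h.le_one hx).hasSum.tendsto_sum_nat

namespace MomentCondition

theorem ae_tendsto_weightedFluctuation [IsProbabilityMeasure P] (h : MomentCondition P ε a β) :
    ∀ᵐ ω ∂P, Tendsto (fun k => weightedFluctuation P ε a β k ω) atTop (𝓝 0) := by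
  have hε := h.iid.measurable
  set v := variance (fun ω => |ε 0 ω| ^ β) P with hv
  have hv0 : 0 ≤ v := variance_nonneg _ _
  have hterm : ∀ j k : ℕ, ∫⁻ ω, ENNReal.ofReal |(∑ i ∈ Finset.Icc 1 (4 ^ k),
      |ε ((i : ℕ) - (j : ℤ)) ω| ^ β) / (Finset.Icc 1 (4 ^ k)).card - ∫ ω, |ε 0 ω| ^ β ∂P| ∂P ≤
      ENNReal.ofReal ((1 + v) * (1 / 2) ^ k) := by
    intro j k
    have hid : ∀ i : ℤ, IdentDistrib (fun ω => |ε i ω| ^ β) (fun ω => |ε (((0 : ℕ) : ℤ) - j) ω| ^ β)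
        P P := fun i => (h.identDistrib_abs_rpow i).trans (h.identDistrib_abs_rpow _).symm
    have H := lintegral_abs_average_sub_le (P := P) (s := Finset.Icc 1 (4 ^ k)) (i₀ := 0)
      (W := fun (i : ℕ) ω => |ε ((i : ℕ) - (j : ℤ)) ω| ^ β)
      (Finset.nonempty_Icc.2 (Nat.one_le_pow _ _ (by norm_num))) ((hid 0).memLp_iff.1 h.memLp) (fun i => hid _)
      (fun i i' hii => (h.iid.indep.indepFun (by simpa using hii)).comp
        (φ := fun x : ℝ => |x| ^ β) (ψ := fun x : ℝ => |x| ^ β) (by fun_prop) (by fun_prop))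
      -- With sample size `4 ^ k`, this choice makes both terms of the bound of order `2 ^ (-k)`.
      (t := (1 / 2) ^ k) (by positivity)
    rw [← (hid 0).integral_eq, ← (hid 0).variance_eq] at H
    refine H.trans_eq (congrArg _ ?_)
    have h4 : (4 : ℝ) ^ k = 2 ^ k * 2 ^ k := by rw [← mul_pow]; norm_num
    rw [← hv, Nat.card_Icc, Nat.add_sub_cancel, one_div, inv_pow]
    push_cast
    rw [h4]
    field_simp
  -- Summable expectations make the series over `k` finite almost surely, so its terms tend to `0`.
  have hsum : ∑' k, ∫⁻ ω, weightedFluctuation P ε a β k ω ∂P ≠ ⊤ := by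
    have hle : ∀ k, ∫⁻ ω, weightedFluctuation P ε a β k ω ∂P ≤
        (∑' j, ‖a j‖ₑ ^ β) * ENNReal.ofReal ((1 + v) * (1 / 2) ^ k) := by
      intro k
      unfold weightedFluctuation
      rw [lintegral_tsum (fun j => by fun_prop), ← ENNReal.tsum_mul_right]
      refine ENNReal.tsum_le_tsum fun j => ?_
      rw [lintegral_const_mul _ (by fun_prop)]
      gcongr
      exact hterm j k
    refine ne_top_of_le_ne_top ?_ (ENNReal.tsum_le_tsum hle)
    rw [ENNReal.tsum_mul_left]
    exact ENNReal.mul_ne_top h.tsum_enorm_rpow_ne_top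
      (summable_geometric_two.mul_left (1 + v)).tsum_ofReal_ne_top
  have hmeas : ∀ k, AEMeasurable (weightedFluctuation P ε a β k) P := fun k => by
    unfold weightedFluctuation
    fun_prop
  rw [← lintegral_tsum hmeas] at hsum
  filter_upwards [ae_lt_top' (AEMeasurable.tsum hmeas) hsum] with ω hω
  have H := ENNReal.tendsto_cofinite_zero_of_tsum_ne_top hω.ne
  rwa [Nat.cofinite_eq_atTop] at H

/-- All terms are nonnegative, so the sum up to `n` is at most the sum up to `4 ^ k`, and `4 ^ k ≤ 4
* n`. The fluctuation term does not depend on `m`, so one null set serves all truncations. -/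
theorem sum_tsum_tail_le (hβ : 0 < β) {n k : ℕ} (hn : n ≤ 4 ^ k) (hk : 4 ^ k ≤ 4 * n) (m : ℕ)
    (ω : Ω) :
    ∑ i ∈ Finset.Icc 1 n, ∑' j : ℕ, ‖a (j + m)‖ₑ ^ β * ‖ε ((i : ℕ) - ((j + m : ℕ) : ℤ)) ω‖ₑ ^ β ≤
      n * (4 * (weightedFluctuation P ε a β k ω +
        (∑' j, ‖a (j + m)‖ₑ ^ β) * ENNReal.ofReal (∫ ω, |ε 0 ω| ^ β ∂P))) := by
  set μ := ∫ ω, |ε 0 ω| ^ β ∂P with hμ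
  set Dv : ℕ → ENNReal := fun j => ENNReal.ofReal |(∑ i ∈ Finset.Icc 1 (4 ^ k),
    |ε ((i : ℕ) - (j : ℤ)) ω| ^ β) / (Finset.Icc 1 (4 ^ k)).card - μ| with hDv
  have hcol : ∀ j : ℕ, ∑ i ∈ Finset.Icc 1 n, ‖ε ((i : ℕ) - (j : ℤ)) ω‖ₑ ^ β ≤
      n * 4 * (Dv j + ENNReal.ofReal μ) := by
    intro j
    calc ∑ i ∈ Finset.Icc 1 n, ‖ε ((i : ℕ) - (j : ℤ)) ω‖ₑ ^ β
        ≤ ∑ i ∈ Finset.Icc 1 (4 ^ k), ‖ε ((i : ℕ) - (j : ℤ)) ω‖ₑ ^ β :=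
          Finset.sum_le_sum_of_subset (Finset.Icc_subset_Icc_right hn)
      _ = ENNReal.ofReal (∑ i ∈ Finset.Icc 1 (4 ^ k), |ε ((i : ℕ) - (j : ℤ)) ω| ^ β) := by
          rw [ENNReal.ofReal_sum_of_nonneg fun i _ => by positivity]
          simp_rw [enorm_rpow_eq_ofReal _ hβ]
      _ = ENNReal.ofReal ((4 ^ k : ℕ) * ((∑ i ∈ Finset.Icc 1 (4 ^ k),
            |ε ((i : ℕ) - (j : ℤ)) ω| ^ β) / (Finset.Icc 1 (4 ^ k)).card)) := by
          rw [Nat.card_Icc, Nat.add_sub_cancel]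
          congr 1
          push_cast
          field_simp
      _ ≤ ENNReal.ofReal ((4 ^ k : ℕ) * (|(∑ i ∈ Finset.Icc 1 (4 ^ k),
            |ε ((i : ℕ) - (j : ℤ)) ω| ^ β) / (Finset.Icc 1 (4 ^ k)).card - μ| + μ)) := by
          refine ENNReal.ofReal_le_ofReal (mul_le_mul_of_nonneg_left ?_ (Nat.cast_nonneg _))
          linarith [le_abs_self ((∑ i ∈ Finset.Icc 1 (4 ^ k),
            |ε ((i : ℕ) - (j : ℤ)) ω| ^ β) / (Finset.Icc 1 (4 ^ k)).card - μ)]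
      _ ≤ ((4 ^ k : ℕ) : ENNReal) * (Dv j + ENNReal.ofReal μ) := by
          rw [ENNReal.ofReal_mul (Nat.cast_nonneg _), ENNReal.ofReal_natCast]
          gcongr
          exact ENNReal.ofReal_add_le
      _ ≤ n * 4 * (Dv j + ENNReal.ofReal μ) := by
          gcongr
          rw [mul_comm]
          exact_mod_cast hk
  calc _ = ∑' j : ℕ, ‖a (j + m)‖ₑ ^ β *
        ∑ i ∈ Finset.Icc 1 n, ‖ε ((i : ℕ) - ((j + m : ℕ) : ℤ)) ω‖ₑ ^ β := by
        rw [← Summable.tsum_finsetSum fun i _ => ENNReal.summable]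
        simp_rw [Finset.mul_sum]
    _ ≤ ∑' j : ℕ, n * 4 * (‖a (j + m)‖ₑ ^ β * Dv (j + m) + ‖a (j + m)‖ₑ ^ β * ENNReal.ofReal μ) := by
        refine ENNReal.tsum_le_tsum fun j => ?_
        refine (mul_le_mul_right (hcol (j + m)) _).trans_eq ?_
        ring
    _ = n * (4 * (∑' j : ℕ, ‖a (j + m)‖ₑ ^ β * Dv (j + m) +
          (∑' j, ‖a (j + m)‖ₑ ^ β) * ENNReal.ofReal μ)) := by
        rw [ENNReal.tsum_mul_left, ENNReal.tsum_add, ENNReal.tsum_mul_right, mul_assoc]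
    _ ≤ _ := by
        gcongr
        exact ENNReal.tsum_comp_le_tsum_of_injective (add_left_injective m)
          fun j => ‖a j‖ₑ ^ β * Dv j

theorem enorm_linearProcess_sub_truncatedProcess_rpow_le (h : MomentCondition P ε a β) {k : ℤ}
    {ω : Ω} (hω : ∑' i : ℕ, ‖a i‖ₑ ^ β * ‖ε (k - i) ω‖ₑ ^ β < ⊤) (m : ℕ) :
    ‖(linearProcess a ε k ω) - truncatedProcess a ε m k ω‖ₑ ^ β ≤
      ∑' j : ℕ, ‖a (j + m)‖ₑ ^ β * ‖ε (k - ((j + m : ℕ) : ℤ)) ω‖ₑ ^ β := by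
  have hs := (summable_mul_of_tsum_rpow_lt_top h.pos h.le_one hω).sum_add_tsum_nat_add m
  unfold linearProcess truncatedProcess
  rw [← hs, add_sub_cancel_left]
  exact enorm_tsum_rpow_le h.pos h.le_one (fun j => a (j + m)) fun j => ε (k - ((j + m : ℕ) : ℤ)) ω

theorem ofReal_abs_average_sub_le (h : MomentCondition P ε a β) {f : ℝ → ℝ} {K : NNReal}
    (hK : LipschitzWith K f) (h01 : ∀ z, f z ∈ Set.Icc (0 : ℝ) 1) {ω : Ω}
    (hω : ∀ k : ℤ, ∑' i : ℕ, ‖a i‖ₑ ^ β * ‖ε (k - i) ω‖ₑ ^ β < ⊤) (m : ℕ) {n k : ℕ} (hn0 : 0 < n)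
    (hn : n ≤ 4 ^ k) (hk : 4 ^ k ≤ 4 * n) :
    ENNReal.ofReal |(∑ i ∈ Finset.Icc 1 n, f (linearProcess a ε (i : ℕ) ω)) / n -
        (∑ i ∈ Finset.Icc 1 n, f (truncatedProcess a ε m (i : ℕ) ω)) / n| ≤
      (K : ENNReal) ^ β * (4 * (weightedFluctuation P ε a β k ω +
        (∑' j, ‖a (j + m)‖ₑ ^ β) * ENNReal.ofReal (∫ ω, |ε 0 ω| ^ β ∂P))) := by
  have hn' : (0 : ℝ) < n := by exact_mod_cast hn0
  rw [← sub_div, abs_div, abs_of_pos hn', ENNReal.ofReal_div_of_pos hn', ENNReal.ofReal_natCast]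
  refine ENNReal.div_le_of_le_mul ?_
  rw [← Finset.sum_sub_distrib]
  calc _ ≤ ENNReal.ofReal (∑ i ∈ Finset.Icc 1 n, |f (linearProcess a ε (i : ℕ) ω) -
          f (truncatedProcess a ε m (i : ℕ) ω)|) :=
        ENNReal.ofReal_le_ofReal (Finset.abs_sum_le_sum_abs _ _)
    _ = ∑ i ∈ Finset.Icc 1 n, ENNReal.ofReal |f (linearProcess a ε (i : ℕ) ω) -
          f (truncatedProcess a ε m (i : ℕ) ω)| :=
        ENNReal.ofReal_sum_of_nonneg fun i _ => abs_nonneg _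
    _ ≤ ∑ i ∈ Finset.Icc 1 n, (K : ENNReal) ^ β *
          ∑' j : ℕ, ‖a (j + m)‖ₑ ^ β * ‖ε ((i : ℕ) - ((j + m : ℕ) : ℤ)) ω‖ₑ ^ β := by
        refine Finset.sum_le_sum fun i _ => ?_
        refine (ofReal_abs_sub_le_of_lipschitz hK h01 h.pos h.le_one _ _).trans ?_
        gcongr
        exact h.enorm_linearProcess_sub_truncatedProcess_rpow_le (hω i) m
    _ ≤ _ := by
        rw [← Finset.mul_sum, mul_assoc]
        gcongr
        refine (sum_tsum_tail_le (P := P) h.pos hn hk m ω).trans_eq ?_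
        ring

/-- The strong law for bounded Lipschitz functions of a linear process. -/
theorem ae_tendsto_linearProcess_average [IsProbabilityMeasure P] (h : MomentCondition P ε a β)
    {f : ℝ → ℝ} {K : NNReal} (hK : LipschitzWith K f) (h01 : ∀ z, f z ∈ Set.Icc (0 : ℝ) 1) :
    ∀ᵐ ω ∂P, Tendsto
      (fun n : ℕ => (∑ i ∈ Finset.Icc 1 n, f (linearProcess a ε (i : ℕ) ω)) / n) atTop
      (𝓝 (∫ ω, f (linearProcess a ε 0 ω) ∂P)) := by
  have hf := hK.continuous.measurable
  have hE : Tendsto (fun m => ∫ ω, f (truncatedProcess a ε m 0 ω) ∂P) atTop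
      (𝓝 (∫ ω, f (linearProcess a ε 0 ω) ∂P)) := by
    refine tendsto_integral_of_dominated_convergence (fun _ => 1)
      (fun m => (hf.comp (measurable_truncatedProcess h.iid m 0)).aestronglyMeasurable)
      (integrable_const _) (fun m => Eventually.of_forall fun ω => ?_) ?_
    · rw [Real.norm_eq_abs, abs_of_nonneg (h01 _).1]
      exact (h01 _).2
    · filter_upwards [h.ae_tsum_lt_top] with ω hω
      exact (hK.continuous.tendsto _).comp
        (summable_mul_of_tsum_rpow_lt_top h.pos h.le_one (hω 0)).hasSum.tendsto_sum_nat
  set μ := ∫ ω, |ε 0 ω| ^ β ∂P with hμ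
  have hKtop : (K : ENNReal) ^ β * 4 ≠ ⊤ :=
    ENNReal.mul_ne_top (ENNReal.rpow_ne_top_of_nonneg h.pos.le ENNReal.coe_ne_top) (by simp)
  have hB : Tendsto (fun m => (K : ENNReal) ^ β * 4 * ((∑' j, ‖a (j + m)‖ₑ ^ β) * ENNReal.ofReal μ))
      atTop (𝓝 0) := by
    have h1 := ENNReal.Tendsto.mul_const (b := ENNReal.ofReal μ)
      (ENNReal.tendsto_sum_nat_add (fun j => ‖a j‖ₑ ^ β) h.tsum_enorm_rpow_ne_top)
      (Or.inr ENNReal.ofReal_ne_top)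
    have h2 := ENNReal.Tendsto.const_mul (a := (K : ENNReal) ^ β * 4) h1 (Or.inr hKtop)
    simpa using h2
  filter_upwards [h.ae_tsum_lt_top, h.ae_tendsto_weightedFluctuation,
    ae_all_iff.2 fun m => ae_tendsto_average_truncatedProcess (a := a) h.iid m hf h01]
    with ω hω hR htr
  rw [Metric.tendsto_nhds]
  intro e he
  have he3 : 0 < ENNReal.ofReal (e / 3) := ENNReal.ofReal_pos.2 (by linarith)
  -- The level `m` is fixed before `n`: it makes both the tail bound and the bias of the truncated
  -- mean smaller than `e / 3`.
  obtain ⟨m, hm1, hm2⟩ := ((hB.eventually_lt_const he3).and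
    (Metric.tendsto_nhds.1 hE (e / 3) (by linarith))).exists
  have hR' : Tendsto (fun k => (K : ENNReal) ^ β * 4 * (weightedFluctuation P ε a β k ω +
      (∑' j, ‖a (j + m)‖ₑ ^ β) * ENNReal.ofReal μ)) atTop
      (𝓝 ((K : ENNReal) ^ β * 4 * (0 + (∑' j, ‖a (j + m)‖ₑ ^ β) * ENNReal.ofReal μ))) :=
    ENNReal.Tendsto.const_mul (hR.add tendsto_const_nhds) (Or.inr hKtop)
  rw [zero_add] at hR'
  obtain ⟨k₀, hk₀⟩ := eventually_atTop.1 (hR'.eventually_lt_const hm1)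
  filter_upwards [eventually_ge_atTop (4 ^ k₀), Metric.tendsto_nhds.1 (htr m) (e / 3) (by linarith)]
    with n hn hn2
  have hn0 : 0 < n := lt_of_lt_of_le (by positivity) hn
  have hlog : 4 ^ Nat.log 4 n ≤ n := Nat.pow_log_le_self 4 hn0.ne'
  -- The exponent is `Nat.log 4 n + 1`, for which `n < 4 ^ k ≤ 4 * n`.
  have H := h.ofReal_abs_average_sub_le hK h01 hω m hn0
    (Nat.lt_pow_succ_log_self (by norm_num : 1 < 4) n).le (by rw [pow_succ]; omega)
  have hk : k₀ ≤ (Nat.log 4 n).succ := (Nat.le_log_of_pow_le (by norm_num) hn).trans (Nat.le_succ _)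
  have H2 := hk₀ _ hk
  rw [mul_assoc] at H2
  have H3 := (ENNReal.ofReal_lt_ofReal_iff (by linarith)).1 (H.trans_lt H2)
  rw [Real.dist_eq] at hm2 hn2 ⊢
  have a1 := abs_lt.1 hm2
  have a2 := abs_lt.1 hn2
  have a3 := abs_lt.1 H3
  rw [abs_lt]
  constructor <;> linarith

end MomentCondition

end Law

end MonotoneTransfer

namespace MonotoneTransfer

/-! ### From the strong law to the transfer estimator. -/

section Final

variable {Ω : Type*} [MeasurableSpace Ω] {P : Measure Ω} [IsProbabilityMeasure P]
  {ε : ℤ → Ω → ℝ} {a : ℕ → ℝ} {β : ℝ}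

theorem momentCondition_of_integrable (hε : IIDInnovations P ε) {α q : ℝ} (hα : 0 < α) (hq : 2 ≤ q)
    (hint : Integrable (fun ω => |ε 0 ω| ^ α) P)
    (hsum : Summable fun i : ℕ => |a i| ^ min (α / q) 1) :
    MomentCondition P ε a (min (α / q) 1) := by
  have hpos : 0 < min (α / q) 1 := lt_min (by positivity) one_pos
  refine ⟨hε, hpos, min_le_right _ _, ?_, hsum⟩
  -- Here `q ≥ 2` enters: a moment of order `α` controls the second moment of `|ε|^β`.
  have hle : min (α / q) 1 * 2 ≤ α := by
    have h1 : α / q ≤ α / 2 := div_le_div_of_nonneg_left hα.le two_pos hq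
    linarith [min_le_left (α / q) 1]
  have hm := hε.measurable 0
  have hmβ : Measurable fun ω => |ε 0 ω| ^ min (α / q) 1 := hm.abs.pow_const _
  rw [memLp_two_iff_integrable_sq hmβ.aestronglyMeasurable]
  refine ((integrable_const (1 : ℝ)).add hint).mono' (hmβ.pow_const 2).aestronglyMeasurable
    (Eventually.of_forall fun ω => ?_)
  rw [Real.norm_eq_abs, abs_of_nonneg (by positivity), ← Real.rpow_mul_natCast (abs_nonneg _)]
  simp only [Pi.add_apply, Nat.cast_ofNat]
  rcases le_total |ε 0 ω| 1 with h | h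
  · have h1 := Real.rpow_le_one (abs_nonneg (ε 0 ω)) h (by positivity : 0 ≤ min (α / q) 1 * 2)
    have h2 : 0 ≤ |ε 0 ω| ^ α := by positivity
    linarith
  · linarith [Real.rpow_le_rpow_of_exponent_le h hle]

theorem AssumptionA2.exists_momentCondition (h : AssumptionA2 P ε a) :
    ∃ β, MomentCondition P ε a β := by
  obtain ⟨α, q, hα, hq, hint, hsum, -⟩ := h.coeff
  exact ⟨_, momentCondition_of_integrable h.iid hα hq.le hint hsum⟩

theorem AssumptionA2Star.exists_momentCondition (h : AssumptionA2Star P ε a) :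
    ∃ β, MomentCondition P ε a β := by
  obtain ⟨α, q, hα, hq, hint, hsum⟩ := h.coeff
  exact ⟨_, momentCondition_of_integrable h.iid hα hq hint ((summable_nat_add_iff 1).1 hsum)⟩

theorem monotone_distFun (P : Measure Ω) [IsProbabilityMeasure P] (X : Ω → ℝ) :
    Monotone (distFun P X) := fun _ _ hxy =>
  measureReal_mono fun ω (hω : X ω ≤ _) => hω.trans hxy

omit [IsProbabilityMeasure P] in
theorem distFun_eq_integral {X : Ω → ℝ} (hX : AEMeasurable X P) (s : ℝ) :
    distFun P X s = ∫ ω, {ω | X ω ≤ s}.indicator 1 ω ∂P := by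
  have hs : NullMeasurableSet {ω | X ω ≤ s} P := hX.nullMeasurable measurableSet_Iic
  rw [integral_indicator₀ hs]
  simp [distFun]

theorem distFun_le_integral_ramp {X : Ω → ℝ} (hX : AEMeasurable X P) {u v : ℝ} (huv : u < v) :
    distFun P X u ≤ ∫ ω, ramp u v (X ω) ∂P := by
  obtain ⟨K, hK⟩ := exists_lipschitzWith_ramp u v
  rw [distFun_eq_integral hX]
  refine integral_mono
    ((integrable_const (1 : ℝ)).indicator₀ (hX.nullMeasurable measurableSet_Iic))
    (Integrable.of_mem_Icc 0 1 (hK.continuous.measurable.comp_aemeasurable hX)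
      (Eventually.of_forall fun ω => ramp_mem_Icc _ _ _)) fun ω => ?_
  classical
  exact indicator_le_ramp huv (X ω)

theorem integral_ramp_le_distFun {X : Ω → ℝ} (hX : AEMeasurable X P) {u v : ℝ} (huv : u < v) :
    ∫ ω, ramp u v (X ω) ∂P ≤ distFun P X v := by
  obtain ⟨K, hK⟩ := exists_lipschitzWith_ramp u v
  rw [distFun_eq_integral hX]
  refine integral_mono
    (Integrable.of_mem_Icc 0 1 (hK.continuous.measurable.comp_aemeasurable hX)
      (Eventually.of_forall fun ω => ramp_mem_Icc _ _ _))
    ((integrable_const (1 : ℝ)).indicator₀ (hX.nullMeasurable measurableSet_Iic)) fun ω => ?_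
  classical
  exact ramp_le_indicator huv (X ω)

/-- Almost surely, the empirical distribution functions of a linear process are eventually
comparable with its distribution function at any two distinct points. -/
theorem MomentCondition.ae_eventually_empiricalDistFun (h : MomentCondition P ε a β) :
    ∀ᵐ ω ∂P, ∀ s t p : ℝ, s < t →
      (p < distFun P (linearProcess a ε 0) s →
        ∀ᶠ n in atTop, p ≤ empiricalDistFun (linearProcess a ε) n ω t) ∧
      (distFun P (linearProcess a ε 0) t < p →
        ∀ᶠ n in atTop, empiricalDistFun (linearProcess a ε) n ω s < p) := by
  have hZ := (identDistrib_linearProcess h 0).aemeasurable_fst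
  have hlim : ∀ u v : ℚ, ∀ᵐ ω ∂P, Tendsto (fun n : ℕ =>
      (∑ i ∈ Finset.Icc 1 n, ramp u v (linearProcess a ε (i : ℕ) ω)) / n) atTop
      (𝓝 (∫ ω, ramp u v (linearProcess a ε 0 ω) ∂P)) := fun u v => by
    obtain ⟨K, hK⟩ := exists_lipschitzWith_ramp (u : ℝ) v
    exact h.ae_tendsto_linearProcess_average hK fun z => ramp_mem_Icc _ _ z
  filter_upwards [ae_all_iff.2 fun u => ae_all_iff.2 (hlim u)] with ω hω s t p hst
  -- Rational ramp endpoints allow a single null set for all real `s < t`.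
  obtain ⟨u, hsu, hut⟩ := exists_rat_btwn hst
  obtain ⟨v, huv, hvt⟩ := exists_rat_btwn hut
  constructor
  · intro hp
    have hp' : p < ∫ ω, ramp u v (linearProcess a ε 0 ω) ∂P :=
      hp.trans_le ((monotone_distFun P _ hsu.le).trans (distFun_le_integral_ramp hZ huv))
    filter_upwards [(hω u v).eventually_const_lt hp'] with n hn
    refine hn.le.trans ?_
    unfold empiricalDistFun
    rw [div_eq_inv_mul, ← one_div]
    refine mul_le_mul_of_nonneg_left (Finset.sum_le_sum fun i _ => ?_) (by positivity)
    refine (ramp_le_indicator huv _).trans ?_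
    split_ifs with h1 h2 h2
    · exact le_rfl
    · exact absurd (h1.trans hvt.le) h2
    · exact zero_le_one
    · exact le_rfl
  · intro hp
    have hp' : ∫ ω, ramp u v (linearProcess a ε 0 ω) ∂P < p :=
      ((integral_ramp_le_distFun hZ huv).trans (monotone_distFun P _ hvt.le)).trans_lt hp
    filter_upwards [(hω u v).eventually_lt_const hp'] with n hn
    refine lt_of_le_of_lt ?_ hn
    unfold empiricalDistFun
    rw [one_div, div_eq_inv_mul]
    refine mul_le_mul_of_nonneg_left (Finset.sum_le_sum fun i _ => ?_)
      (inv_nonneg.2 (Nat.cast_nonneg n))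
    refine le_trans ?_ (indicator_le_ramp huv _)
    split_ifs with h1 h2 h2
    · exact le_rfl
    · exact absurd (h1.trans hsu.le) h2
    · exact zero_le_one
    · exact le_rfl

/-- Slopes at `x` are positive near `x`, which gives strict inequality at nearby points;
monotonicity carries it to all points on either side. -/
theorem lt_and_lt_of_deriv_pos {F : ℝ → ℝ} (hF : Monotone F) {x : ℝ} (hx : 0 < deriv F x) :
    (∀ y, y < x → F y < F x) ∧ ∀ y, x < y → F x < F y := by
  have hd := (differentiableAt_of_deriv_ne_zero hx.ne').hasDerivAt
  have hs := (hasDerivAt_iff_tendsto_slope.1 hd).eventually_const_lt hx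
  constructor
  · intro y hy
    obtain ⟨z, hz, hzy⟩ := ((hs.filter_mono (nhdsLT_le_nhdsNE x)).and
      (Ioo_mem_nhdsLT hy)).exists
    rw [slope_def_field] at hz
    have h1 := (div_pos_iff.1 hz).resolve_left fun h => by linarith [hzy.2, h.2]
    linarith [hF hzy.1.le, h1.1]
  · intro y hy
    obtain ⟨z, hz, hzy⟩ := ((hs.filter_mono (nhdsGT_le_nhdsNE x)).and
      (Ioo_mem_nhdsGT hy)).exists
    rw [slope_def_field] at hz
    have h1 := (div_pos_iff.1 hz).resolve_right fun h => by linarith [hzy.1, h.2]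
    linarith [hF hzy.2.le, h1.1]

/-- A point at which the density is positive belongs to every interval carrying the law. -/
theorem mem_of_densityFun_pos {X : Ω → ℝ} {D : Set ℝ} (hD : D.OrdConnected)
    (hX : ∀ᵐ ω ∂P, X ω ∈ D) {x : ℝ} (hx : 0 < densityFun P X x) : x ∈ D := by
  by_contra hxD
  have hside : (∀ y ∈ D, y < x) ∨ ∀ y ∈ D, x < y := by
    by_contra! hcon
    obtain ⟨⟨y, hy, hxy⟩, z, hz, hzx⟩ := hcon
    exact hxD (hD.out hz hy ⟨hzx, hxy⟩)
  -- Outside `D` the distribution function takes an extreme value, `1` or `0`, so its derivative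
  -- vanishes there.
  refine hx.ne' ?_
  rcases hside with hs | hs
  · have h1 : distFun P X x = 1 := by
      have : {ω | X ω ≤ x} =ᵐ[P] Set.univ := by
        filter_upwards [hX] with ω hω
        exact propext ⟨fun _ => trivial, fun _ => (hs _ hω).le⟩
      rw [distFun, measureReal_congr this, probReal_univ]
    exact IsLocalMax.deriv_eq_zero (Eventually.of_forall fun y => by
      rw [h1]; exact measureReal_le_one)
  · have h0 : distFun P X x = 0 := by
      have : {ω | X ω ≤ x} =ᵐ[P] (∅ : Set Ω) := by
        filter_upwards [hX] with ω hω
        exact propext ⟨fun h : X ω ≤ x => absurd (hs _ hω) h.not_gt, fun h => h.elim⟩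
      rw [distFun, measureReal_congr this, measureReal_empty]
    exact IsLocalMin.deriv_eq_zero (Eventually.of_forall fun y => by
      rw [h0]; exact measureReal_nonneg)

/-- Almost surely, the estimators converge at all points where the density is positive. -/
theorem MomentCondition.ae_tendsto_transferEstimator (h : MomentCondition P ε a β) {D : Set ℝ}
    (hD_open : IsOpen D) (hD : D.OrdConnected) (hZD : ∀ᵐ ω ∂P, linearProcess a ε 0 ω ∈ D)
    {g : ℝ → ℝ} (hg : StrictMonoOn g D) (hgc : ContinuousOn g D) :
    ∀ᵐ ω ∂P, ∀ x, 0 < densityFun P (linearProcess a ε 0) x →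
      Tendsto (fun n => transferEstimator P (linearProcess a ε) g n ω x) atTop (𝓝 (g x)) := by
  have hmem : ∀ᵐ ω ∂P, ∀ k, linearProcess a ε k ω ∈ D := ae_all_iff.2 fun k =>
    (identDistrib_linearProcess h k).symm.ae_mem_snd hD_open.measurableSet hZD
  filter_upwards [hmem, h.ae_eventually_empiricalDistFun] with ω hω hF x hx
  obtain ⟨hl, hr⟩ := lt_and_lt_of_deriv_pos (monotone_distFun P _) hx
  have hxD := mem_of_densityFun_pos hD hZD hx
  refine tendsto_sampleQuantile_comp hD_open hg hω hxD (hgc.continuousAt (hD_open.mem_nhds hxD))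
    (fun y hy => ?_) fun y hy => ?_
  · obtain ⟨s, hs, hsy⟩ := exists_between hy
    exact (hF s y _ hsy).1 (hr s hs)
  · obtain ⟨t, hyt, ht⟩ := exists_between hy
    exact (hF y t _ hyt).2 (hl t ht)

theorem densityFun_nonneg (P : Measure Ω) [IsProbabilityMeasure P] (X : Ω → ℝ) (x : ℝ) :
    0 ≤ densityFun P X x :=
  (monotone_distFun P X).deriv_nonneg

theorem transferEstimator_monotoneOn (Z : ℤ → Ω → ℝ) (g : ℝ → ℝ) {n : ℕ} (hn : 0 < n) (ω : Ω)
    {c : ℝ} (hc : 0 < distFun P (Z 0) c) :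
    MonotoneOn (transferEstimator P Z g n ω) (Set.Ici c) := fun _ hx _ _ hxy =>
  sampleQuantile_mono _ hn ω (hc.trans_le (monotone_distFun P _ hx)) measureReal_le_one
    (monotone_distFun P _ hxy)

end Final

end MonotoneTransfer

theorem mainTheorem6 {Ω : Type*} [MeasurableSpace Ω] (P : Measure Ω) [IsProbabilityMeasure P]
    (ε : ℤ → Ω → ℝ) (a : ℕ → ℝ)
    (D : Set ℝ) (hD_open : IsOpen D) (hD_interval : D.OrdConnected)
    (hZD : ∀ᵐ ω ∂P, MonotoneTransfer.linearProcess a ε 0 ω ∈ D)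
    (g : ℝ → ℝ) (hg_mono : StrictMonoOn g D) (hg_diff : DifferentiableOn ℝ g D) :
    (MonotoneTransfer.AssumptionA2 P ε a →
      ∀ x : ℝ, 0 < MonotoneTransfer.densityFun P (MonotoneTransfer.linearProcess a ε 0) x →
        ∀ᵐ ω ∂P, Tendsto
          (fun n : ℕ =>
            MonotoneTransfer.transferEstimator P (MonotoneTransfer.linearProcess a ε) g n ω x)
          atTop (𝓝 (g x))) ∧
    (MonotoneTransfer.AssumptionA2Star P ε a →
      ∀ c d : ℝ, c ≤ d →
        0 < (⨅ x : Set.Icc c d,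
          MonotoneTransfer.densityFun P (MonotoneTransfer.linearProcess a ε 0) (x : ℝ)) →
        ∀ᵐ ω ∂P, TendstoUniformlyOn
          (fun (n : ℕ) (x : ℝ) =>
            MonotoneTransfer.transferEstimator P (MonotoneTransfer.linearProcess a ε) g n ω x)
          g atTop (Set.Icc c d)) := by
  constructor
  · intro hA x hx
    obtain ⟨β, h⟩ := hA.exists_momentCondition
    filter_upwards [h.ae_tendsto_transferEstimator hD_open hD_interval hZD hg_mono
      hg_diff.continuousOn] with ω hω using hω x hx
  · intro hA c d hcd hinf
    obtain ⟨β, h⟩ := hA.exists_momentCondition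
    set Z := MonotoneTransfer.linearProcess a ε
    have hpos : ∀ x ∈ Set.Icc c d, 0 < MonotoneTransfer.densityFun P (Z 0) x := fun x hx =>
      hinf.trans_le (ciInf_le (f := fun x : Set.Icc c d =>
          MonotoneTransfer.densityFun P (Z 0) (x : ℝ))
        ⟨0, Set.forall_mem_range.2 fun y => MonotoneTransfer.densityFun_nonneg P _ _⟩ ⟨x, hx⟩)
    -- Positivity of `F_Z(c)` keeps all quantile levels on `[c, d]` positive, as monotonicity of the
    -- estimator requires.
    have hc : 0 < MonotoneTransfer.distFun P (Z 0) c :=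
      measureReal_nonneg.trans_lt ((MonotoneTransfer.lt_and_lt_of_deriv_pos
        (MonotoneTransfer.monotone_distFun P _) (hpos c ⟨le_rfl, hcd⟩)).1 (c - 1) (by linarith))
    have hsub : Set.Icc c d ⊆ D := fun x hx =>
      MonotoneTransfer.mem_of_densityFun_pos hD_interval hZD (hpos x hx)
    filter_upwards [h.ae_tendsto_transferEstimator hD_open hD_interval hZD hg_mono
      hg_diff.continuousOn] with ω hω
    refine MonotoneTransfer.tendstoUniformlyOn_Icc_of_monotoneOn ?_
      (hg_diff.continuousOn.mono hsub) fun x hx => hω x (hpos x hx)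
    filter_upwards [eventually_gt_atTop 0] with n hn
    exact (MonotoneTransfer.transferEstimator_monotoneOn Z g hn ω hc).mono Set.Icc_subset_Ici_self
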